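/- For an even integer $n\ge 4$ let $\mathrm{EQ}'_n$ be the promise problem (partial Boolean function) on pairs $x,y\in\{0,1\}^n$ with $$\mathrm{EQ}'_n(x,y)=\begin{cases}1 & \text{if } H(x,y)\in\{0,1,n-1,n\},\\ 0 & \text{if } H(x,y)=n/2,\end{cases}$$ and undefined for all other pairs, where $H$ is the Hamming distance. Let $D(\mathrm{EQ}'_n)$ be its deterministic communication complexity: the least $c$ for which there is a deterministic two-party protocol (Alice holds $x$, Bob holds $y$) that outputs $\mathrm{EQ}'_n(x,y)$ on every promised pair $(x,y)$ and exchanges at most $c$ bits on every promised pair. Then $D(\mathrm{EQ}'_n)\in\Omega(n)$: there is a constant $c>0$ such that $D(\mathrm{EQ}'_n)\ge c\,n$ for every even $n\ge 4$. In fact, $D(\mathrm{EQ}'_n)>0.0072\,n$ for all sufficiently large even $n$. -/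

import Mathlib

/-- A deterministic two-party communication protocol (protocol tree) for Alice, who holds an
element of `X`, and Bob, who holds an element of `Y`. At `output b` the communication has
terminated with output `b`. At `alice a P₀ P₁` Alice, holding `x`, sends the bit `a x`, and the
protocol goes on with `P₁` if the bit is `1` and with `P₀` if it is `0`; `bob b P₀ P₁` is the same
with Bob as the sender. Hence everything but the value of the next bit depends only on the
communication so far, and the next bit depends on that and on the input of its sender. -/
inductive CommProtocol (X Y : Type) : Type where
  | output (b : Bool) : CommProtocol X Y
  | alice (a : X → Bool) (P₀ P₁ : CommProtocol X Y) : CommProtocol X Y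
  | bob (b : Y → Bool) (P₀ P₁ : CommProtocol X Y) : CommProtocol X Y

namespace CommProtocol

variable {X Y : Type}

/-- The output of a protocol on the input pair `(x, y)`. -/
def eval : CommProtocol X Y → X → Y → Bool
  | output b, _, _ => b
  | alice a P₀ P₁, x, y => if a x then P₁.eval x y else P₀.eval x y
  | bob b P₀ P₁, x, y => if b y then P₁.eval x y else P₀.eval x y

/-- The number of bits exchanged by a protocol on the input pair `(x, y)`. -/
def bits : CommProtocol X Y → X → Y → ℕ
  | output _, _, _ => 0
  | alice a P₀ P₁, x, y => (if a x then P₁.bits x y else P₀.bits x y) + 1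
  | bob b P₀ P₁, x, y => (if b y then P₁.bits x y else P₀.bits x y) + 1

/-- `P` computes the partial function `f` (`none` means: not promised): on every promised input
pair the output of `P` is the value of `f`. -/
def Computes (P : CommProtocol X Y) (f : X → Y → Option Bool) : Prop :=
  ∀ x y v, f x y = some v → P.eval x y = v

end CommProtocol

/-- The deterministic communication complexity `D(f)` of a partial function `f`: the least `c` such
that some deterministic protocol computes `f` and exchanges at most `c` bits on every promised
input pair. -/
noncomputable def detCommComplexity {X Y : Type} (f : X → Y → Option Bool) : ℕ :=
  sInf {c : ℕ | ∃ P : CommProtocol X Y, P.Computes f ∧ ∀ x y, f x y ≠ none → P.bits x y ≤ c}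

/-- The promise problem `EQ'` on pairs of `n`-bit strings: `1` if the Hamming distance is `0`, `1`,
`n - 1` or `n`, and `0` if it is `n / 2`; all other pairs are not promised. (The two cases exclude
each other for even `n ≥ 4`.) -/
def EQPrime (n : ℕ) (x y : Fin n → Bool) : Option Bool :=
  if hammingDist x y = 0 ∨ hammingDist x y = 1 ∨ hammingDist x y + 1 = n ∨ hammingDist x y = n then
    some true
  else if 2 * hammingDist x y = n then some false
  else none

/-!
A protocol that exchanges at most `c` bits puts a `2⁻ᶜ` fraction of all diagonal pairs into one
leaf. A leaf is a rectangle, so this yields a set `S` of that density such that no two elements of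
`S`, one given to Alice and one to Bob, have distance `n / 2`. The theorem follows
from an explicit Frankl–Rödl bound: such a set has density at most about `2^(-0.008 n)`.

The bits are grouped in pairs. A pair of bits is a letter in `Bool × Bool`, made of the class (the
parity of the two bits) and a sign; the four letters behave like `±e₁, ±e₂` in the plane under
`letterProd`, and two words of `M` letters have Hamming distance `M` minus their inner product
`wordProd`. Distance `n / 2` thus means inner product `0`. For even `M`, words with the same parity
of the number of letters of class `true` have an even inner product, so after halving `S` all inner
products have absolute value at least `2`. If `n ≡ 2 (mod 4)`, two further bits are added, equal
for Alice and different for Bob: this is where the promise at distance `1` is needed.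

The bound (`log_wordDens_lt_of_le_abs_wordProd`) is proved for two sets `F`, `G` of words whose
inner products all have absolute value at least `k ≥ 2`, by induction on the length. Choose a
position `p` and slice `F` and `G` by the letter at `p`. Let `U_j`, `I_j` be the union and the
intersection of the two slices of class `j`.
* The union `U_j` of `F` and the union of the other class of `G` are again such a pair with the
  same `k`, because letters of different classes are orthogonal.
* The union `U_j` of `F` and the intersection `I_j` of `G` (or the other way round) are such a pair
  with `k + 1`: both `1 + e` and `-1 + e` have to stay away from `(-k, k)`.
If unions are much larger than the average slice, a step of the first kind increases the product of
the densities; otherwise intersections are almost as large as unions, and a step of the second kind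
loses little density while `k` grows. Hence `wordDens F * wordDens G * (5 / 4) ^ k` grows by a
factor `1.09` (`exists_restriction`), provided that neither set has a large class bias at `p`.
Such a `p` exists by the level-one inequality `sum_bias_sq_le`, because the densities cannot be too small:
the large deviation bound `wordDens_le_of_le_abs_wordProd` controls the weight `(5 / 4) ^ k`. The
growth is faster than the potential can afford, and the words run out while `k ≥ 2`.
-/

open Finset

/-! ### The letter product -/

/-- The inner product of two letters. A letter is a pair (class, sign); letters of different classes
are orthogonal, and letters of the same class have product `1` or `-1` according to their signs. -/
def letterProd (a b : Bool × Bool) : ℤ :=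
  if a.1 = b.1 then (if a.2 = b.2 then 1 else -1) else 0

/-- The inner product of two words of `M` letters. -/
def wordProd {M : ℕ} (x y : Fin M → Bool × Bool) : ℤ := ∑ p, letterProd (x p) (y p)

lemma letterProd_comm (a b : Bool × Bool) : letterProd a b = letterProd b a := by
  simp only [letterProd, eq_comm]

lemma wordProd_comm {M : ℕ} (x y : Fin M → Bool × Bool) : wordProd x y = wordProd y x := by
  simp only [wordProd, letterProd_comm]

lemma wordProd_insertNth {M : ℕ} (p : Fin (M + 1)) (c d : Bool × Bool)
    (z w : Fin M → Bool × Bool) :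
    wordProd (p.insertNth c z : Fin (M + 1) → Bool × Bool) (p.insertNth d w) =
      letterProd c d + wordProd z w := by
  simp [wordProd, Fin.sum_univ_succAbove _ p]

/-- The words of length `M` that belong to `F` once the letter `c` is inserted at position `p`. -/
def letterSlice {M : ℕ} (F : Finset (Fin (M + 1) → Bool × Bool)) (p : Fin (M + 1)) (c : Bool × Bool) :
    Finset (Fin M → Bool × Bool) :=
  univ.filter fun z => (p.insertNth c z : Fin (M + 1) → Bool × Bool) ∈ F

lemma mem_letterSlice {M : ℕ} {F : Finset (Fin (M + 1) → Bool × Bool)} {p : Fin (M + 1)}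
    {c : Bool × Bool} {z : Fin M → Bool × Bool} :
    z ∈ letterSlice F p c ↔ (p.insertNth c z : Fin (M + 1) → Bool × Bool) ∈ F := by
  simp [letterSlice]

lemma sum_apply_eq_sum_card_letterSlice {M : ℕ} (F : Finset (Fin (M + 1) → Bool × Bool))
    (p : Fin (M + 1)) (h : Bool × Bool → ℝ) :
    ∑ x ∈ F, h (x p) = ∑ c, ((letterSlice F p c).card : ℝ) * h c := by
  classical
  have h1 : ∑ x ∈ F, h (x p) = ∑ x, if x ∈ F then h (x p) else 0 := by
    rw [← Finset.sum_filter]; simp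
  rw [h1, ← (Fin.insertNthEquiv (fun _ => Bool × Bool) p).sum_comp, Fintype.sum_prod_type]
  refine Finset.sum_congr rfl fun c _ => ?_
  rw [letterSlice, Finset.card_filter]
  push_cast
  rw [Finset.sum_mul]
  refine Finset.sum_congr rfl fun z _ => ?_
  simp [Fin.insertNthEquiv]

/-- The density of a set of words among all `4 ^ M` words, as a real number. -/
noncomputable def wordDens {M : ℕ} (F : Finset (Fin M → Bool × Bool)) : ℝ := F.card / 4 ^ M

lemma wordDens_pos {M : ℕ} {F : Finset (Fin M → Bool × Bool)} : 0 < wordDens F ↔ F.Nonempty := by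
  rw [wordDens, div_pos_iff_of_pos_right (by positivity), Nat.cast_pos, card_pos]

lemma wordDens_nonneg {M : ℕ} (F : Finset (Fin M → Bool × Bool)) : 0 ≤ wordDens F := by
  unfold wordDens; positivity

/-! ### Two exponential moment bounds -/

lemma sum_prod_eq_prod_sum {M : ℕ} (φ : Fin M → Bool × Bool → ℝ) :
    ∑ x : Fin M → Bool × Bool, ∏ p, φ p (x p) = ∏ p, ∑ c, φ p c :=
  (Fintype.prod_sum φ).symm

/-- A large deviation bound: few words have a large inner product with a fixed word. It is the
exponential moment bound at the base `5 / 4`; a single letter contributes the average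
`(1 + 1 + 5 / 4 + 4 / 5) / 4 = 81 / 80`. -/
lemma wordDens_le_of_le_abs_wordProd {M : ℕ} {G : Finset (Fin M → Bool × Bool)}
    {x : Fin M → Bool × Bool} {k : ℕ} (h : ∀ y ∈ G, (k : ℤ) ≤ |wordProd x y|) :
    wordDens G * (5 / 4) ^ k ≤ 2 * (81 / 80) ^ M := by
  have key : ∀ r : ℝ, (r = 5 / 4 ∨ r = 4 / 5) →
      ∑ y : Fin M → Bool × Bool, r ^ wordProd x y = (81 / 20) ^ M := by
    intro r hr
    have h0 : r ≠ 0 := by rcases hr with rfl | rfl <;> norm_num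
    have h1 : ∀ y : Fin M → Bool × Bool,
        r ^ wordProd x y = ∏ p, r ^ letterProd (x p) (y p) := by
      intro y
      simp only [wordProd]
      induction (univ : Finset (Fin M)) using Finset.induction_on with
      | empty => simp
      | insert a s ha ih => rw [sum_insert ha, prod_insert ha, zpow_add₀ h0, ih]
    simp only [h1]
    rw [sum_prod_eq_prod_sum (fun p c => r ^ letterProd (x p) c)]
    have h2 : ∀ a : Bool × Bool, ∑ c, r ^ letterProd a c = 81 / 20 := by
      rintro ⟨a, b⟩
      rcases hr with rfl | rfl <;> cases a <;> cases b <;>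
        norm_num [letterProd, Fintype.sum_prod_type]
    simp only [h2, prod_const, card_univ, Fintype.card_fin]
  have h3 : ∀ y ∈ G, (5 / 4 : ℝ) ^ k ≤
      (5 / 4 : ℝ) ^ wordProd x y + (4 / 5 : ℝ) ^ wordProd x y := by
    intro y hy
    have hk := h y hy
    have e : (4 / 5 : ℝ) ^ wordProd x y = (5 / 4 : ℝ) ^ (-wordProd x y) := by
      rw [zpow_neg, ← inv_zpow]; norm_num
    rw [e, ← zpow_natCast]
    have p1 : (0 : ℝ) < (5 / 4 : ℝ) ^ wordProd x y := by positivity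
    have p2 : (0 : ℝ) < (5 / 4 : ℝ) ^ (-wordProd x y) := by positivity
    rcases le_abs.1 hk with hk | hk
    · linarith [zpow_le_zpow_right₀ (by norm_num : (1 : ℝ) ≤ 5 / 4) hk]
    · linarith [zpow_le_zpow_right₀ (by norm_num : (1 : ℝ) ≤ 5 / 4) hk]
  have h4 : (G.card : ℝ) * (5 / 4) ^ k ≤ 2 * (81 / 20) ^ M := by
    calc (G.card : ℝ) * (5 / 4) ^ k = ∑ y ∈ G, (5 / 4 : ℝ) ^ k := by simp
      _ ≤ ∑ y ∈ G, ((5 / 4 : ℝ) ^ wordProd x y + (4 / 5 : ℝ) ^ wordProd x y) :=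
          sum_le_sum h3
      _ ≤ ∑ y, ((5 / 4 : ℝ) ^ wordProd x y + (4 / 5 : ℝ) ^ wordProd x y) :=
          sum_le_sum_of_subset_of_nonneg (subset_univ _) fun _ _ _ => by positivity
      _ = 2 * (81 / 20) ^ M := by
          rw [sum_add_distrib, key _ (Or.inl rfl), key _ (Or.inr rfl)]; ring
  have h5 : (81 / 20 : ℝ) ^ M = (81 / 80) ^ M * 4 ^ M := by rw [← mul_pow]; norm_num
  rw [wordDens, div_mul_eq_mul_div, div_le_iff₀ (by positivity)]
  linarith

/-- The class of a letter as a sign: `1` for `false` and `-1` for `true`. -/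
noncomputable def classSign (a : Bool × Bool) : ℝ := if a.1 then -1 else 1

/-- The mean of the sign of the class at position `p` over the words of `F`. -/
noncomputable def bias {M : ℕ} (F : Finset (Fin M → Bool × Bool)) (p : Fin M) : ℝ :=
  (∑ x ∈ F, classSign (x p)) / F.card

/-- The level-one inequality: the class biases of a set of density `δ` have square sum at most
`2 log (1 / δ)`. The linear form with the biases as coefficients has mean `∑ p, bias F p ^ 2` on
`F`, while its exponential moment on all words is at most `exp ((∑ p, bias F p ^ 2) / 2)`. -/
lemma sum_bias_sq_le {M : ℕ} {F : Finset (Fin M → Bool × Bool)} (hF : F.Nonempty) :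
    ∑ p, bias F p ^ 2 ≤ -2 * Real.log (wordDens F) := by
  set Q := ∑ p, bias F p ^ 2 with hQ
  have hc : (0 : ℝ) < F.card := by exact_mod_cast hF.card_pos
  have h1 : ∑ x : Fin M → Bool × Bool, Real.exp (∑ p, bias F p * classSign (x p)) ≤
      4 ^ M * Real.exp (Q / 2) := by
    simp only [Real.exp_sum]
    rw [sum_prod_eq_prod_sum (fun p c => Real.exp (bias F p * classSign c))]
    have h2 : ∀ p, ∑ c, Real.exp (bias F p * classSign c) ≤
        4 * Real.exp (bias F p ^ 2 / 2) := by
      intro p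
      have := Real.cosh_le_exp_half_sq (bias F p)
      rw [Real.cosh_eq] at this
      simp [classSign, Fintype.sum_prod_type]
      linarith
    calc _ ≤ ∏ p : Fin M, 4 * Real.exp (bias F p ^ 2 / 2) :=
          prod_le_prod (fun p _ => by positivity) fun p _ => h2 p
      _ = 4 ^ M * Real.exp (Q / 2) := by
          rw [prod_mul_distrib, ← Real.exp_sum, ← sum_div]; simp [hQ]
  have h3 : (F.card : ℝ) * Real.exp Q ≤
      ∑ x ∈ F, Real.exp (∑ p, bias F p * classSign (x p)) := by
    have h4 : ∑ x ∈ F, ∑ p, bias F p * classSign (x p) = F.card * Q := by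
      rw [sum_comm, hQ, mul_sum]
      refine sum_congr rfl fun p _ => ?_
      rw [← mul_sum]
      have : ∑ x ∈ F, classSign (x p) = F.card * bias F p := by
        rw [bias]; field_simp
      rw [this]; ring
    -- the tangent line of `exp` at the mean `Q`
    have h5 : ∀ u : ℝ, Real.exp Q * (1 + (u - Q)) ≤ Real.exp u := by
      intro u
      have := Real.add_one_le_exp (u - Q)
      calc _ ≤ Real.exp Q * Real.exp (u - Q) := by gcongr; linarith
        _ = _ := by rw [← Real.exp_add]; ring_nf
    calc (F.card : ℝ) * Real.exp Q
        = ∑ x ∈ F, Real.exp Q * (1 + ((∑ p, bias F p * classSign (x p)) - Q)) := by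
          rw [← mul_sum, sum_add_distrib, sum_sub_distrib, h4]; simp; ring
      _ ≤ _ := sum_le_sum fun x _ => h5 _
  have h6 : (F.card : ℝ) * Real.exp Q ≤ 4 ^ M * Real.exp (Q / 2) :=
    h3.trans ((sum_le_sum_of_subset_of_nonneg (subset_univ _)
      fun _ _ _ => by positivity).trans h1)
  have h7 : wordDens F ≤ Real.exp (-(Q / 2)) := by
    rw [wordDens, div_le_iff₀ (by positivity), Real.exp_neg, inv_mul_eq_div,
      le_div_iff₀ (by positivity)]
    have : Real.exp Q = Real.exp (Q / 2) * Real.exp (Q / 2) := by rw [← Real.exp_add]; ring_nf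
    rw [this, ← mul_assoc] at h6
    exact le_of_mul_le_mul_right h6 (by positivity)
  have := (Real.log_le_iff_le_exp (wordDens_pos.2 hF)).2 h7
  linarith

/-! ### Restricting to one letter -/

/-- The numerical core of the restriction step. Here `s`, `t` are the class biases of two sets, and
`1 ± a`, `1 ± b` and `1 ± c`, `1 ± d` are the sizes of the union and the intersection of the slices
of class `false` and `true`, relative to their mean. The first two products belong to the steps
that keep `k`, the other four, with the factor `5 / 4`, to those that increase it. If the first two
were both less than `1.09`, then `a + b + c + d` would be small, and so the geometric mean of the
other four would be at least `1.09`. -/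
lemma gain_of_bias_small {s t a b c d : ℝ} (hst : s ^ 2 + t ^ 2 ≤ 0.14)
    (ha : 0 ≤ a) (ha1 : a ≤ 1) (hb : 0 ≤ b) (hb1 : b ≤ 1)
    (hc : 0 ≤ c) (hc1 : c ≤ 1) (hd : 0 ≤ d) (hd1 : d ≤ 1) :
    1.09 ≤ ((1 + s) * (1 + a)) * ((1 - t) * (1 + d)) ∨
    1.09 ≤ ((1 - s) * (1 + b)) * ((1 + t) * (1 + c)) ∨
    1.09 ≤ ((1 + s) * (1 + a)) * ((1 + t) * (1 - c)) * (5 / 4) ∨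
    1.09 ≤ ((1 + s) * (1 - a)) * ((1 + t) * (1 + c)) * (5 / 4) ∨
    1.09 ≤ ((1 - s) * (1 + b)) * ((1 - t) * (1 - d)) * (5 / 4) ∨
    1.09 ≤ ((1 - s) * (1 - b)) * ((1 - t) * (1 + d)) * (5 / 4) := by
  by_contra! hcon
  obtain ⟨h1, h2, h3, h4, h5, h6⟩ := hcon
  have hs : s ^ 2 ≤ 0.14 := by nlinarith [sq_nonneg t]
  have ht : t ^ 2 ≤ 0.14 := by nlinarith [sq_nonneg s]
  have s1 : 0 ≤ 1 + s := by nlinarith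
  have s2 : 0 ≤ 1 - s := by nlinarith
  have t1 : 0 ≤ 1 + t := by nlinarith
  have t2 : 0 ≤ 1 - t := by nlinarith
  have a2 : 0 ≤ 1 - a := by linarith
  have b2 : 0 ≤ 1 - b := by linarith
  have c2 : 0 ≤ 1 - c := by linarith
  have d2 : 0 ≤ 1 - d := by linarith
  obtain ⟨S, hS⟩ : ∃ S, S = (1 - s ^ 2) * (1 - t ^ 2) := ⟨_, rfl⟩
  obtain ⟨A, hA⟩ : ∃ A, A = (1 + a) * (1 + b) * ((1 + c) * (1 + d)) := ⟨_, rfl⟩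
  obtain ⟨B, hB⟩ : ∃ B, B = (1 - a) * (1 - b) * ((1 - c) * (1 - d)) := ⟨_, rfl⟩
  have hS1 : 0.86 ≤ S := by
    rw [hS]; linarith [mul_nonneg (sq_nonneg s) (sq_nonneg t)]
  have hA1 : 1 + (a + b + c + d) ≤ A := by
    have e1 : 1 + (a + b) ≤ (1 + a) * (1 + b) := by linarith [mul_nonneg ha hb]
    have e2 : 1 + (c + d) ≤ (1 + c) * (1 + d) := by linarith [mul_nonneg hc hd]
    rw [hA]
    have := mul_le_mul e1 e2 (by positivity) (by positivity)
    linarith [mul_nonneg (add_nonneg ha hb) (add_nonneg hc hd)]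
  have hN : S * A ≤ 1.09 * 1.09 := by
    have := mul_le_mul h1.le h2.le (by positivity) (by norm_num)
    calc S * A = _ := by rw [hS, hA]; ring
      _ ≤ _ := this
  have hσ : a + b + c + d ≤ 0.3816 := by
    have := mul_le_mul hS1 hA1 (by positivity) (by linarith)
    linarith
  have hB1 : 1 - (a + b + c + d) ≤ B := by
    have e1 : 1 - (a + b) ≤ (1 - a) * (1 - b) := by linarith [mul_nonneg ha hb]
    have e2 : 1 - (c + d) ≤ (1 - c) * (1 - d) := by linarith [mul_nonneg hc hd]
    rw [hB]
    have := mul_le_mul e1 e2 (by linarith) (by positivity)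
    linarith [mul_nonneg (add_nonneg ha hb) (add_nonneg hc hd)]
  have hAB : 0.854 ≤ A * B := by
    have := mul_le_mul hA1 hB1 (by linarith) (by linarith)
    have hσ0 : 0 ≤ a + b + c + d := by linarith
    have := mul_le_mul hσ hσ hσ0 (by norm_num)
    linarith
  have hW : (5 / 4) ^ 4 * (S ^ 2 * (A * B)) ≤ (1.09 * 1.09) * (1.09 * 1.09) := by
    have e1 := mul_le_mul h3.le h4.le (by positivity) (by norm_num)
    have e2 := mul_le_mul h5.le h6.le (by positivity) (by norm_num)
    have := mul_le_mul e1 e2 (by positivity) (by norm_num)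
    calc _ = _ := by rw [hS, hA, hB]; ring
      _ ≤ _ := this
  have hS2 : 0.7396 ≤ S ^ 2 := by
    have := pow_le_pow_left₀ (by norm_num) hS1 2
    norm_num at this ⊢
    exact this
  have := mul_le_mul hS2 hAB (by norm_num) (by positivity)
  norm_num at this hW
  linarith

/-- At a position where both sets have a small class bias, the two sets can be replaced by sets of
words without this position, so that `wordDens F * wordDens G * (5 / 4) ^ k` grows by the factor
`1.09`. -/
lemma exists_restriction {M : ℕ} {F G : Finset (Fin (M + 1) → Bool × Bool)} {k : ℕ}
    (hF : F.Nonempty) (hG : G.Nonempty) (hk : 2 ≤ k)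
    (h : ∀ x ∈ F, ∀ y ∈ G, (k : ℤ) ≤ |wordProd x y|) (p : Fin (M + 1))
    (hp : bias F p ^ 2 + bias G p ^ 2 ≤ 0.14) :
    ∃ (F' G' : Finset (Fin M → Bool × Bool)) (k' : ℕ), 2 ≤ k' ∧
      (∀ x ∈ F', ∀ y ∈ G', (k' : ℤ) ≤ |wordProd x y|) ∧
      1.09 * (wordDens F * wordDens G * (5 / 4) ^ k) ≤ wordDens F' * wordDens G' * (5 / 4) ^ k' := by
  classical
  let U (H : Finset (Fin (M + 1) → Bool × Bool)) (j : Bool) :=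
    letterSlice H p (j, false) ∪ letterSlice H p (j, true)
  let I (H : Finset (Fin (M + 1) → Bool × Bool)) (j : Bool) :=
    letterSlice H p (j, false) ∩ letterSlice H p (j, true)
  have hU : ∀ H j z, z ∈ U H j ↔
      ∃ b, (p.insertNth (j, b) z : Fin (M + 1) → Bool × Bool) ∈ H := by
    intro H j z; simp [U, mem_letterSlice]
  have hI : ∀ H j z, z ∈ I H j ↔
      ∀ b, (p.insertNth (j, b) z : Fin (M + 1) → Bool × Bool) ∈ H := by
    intro H j z; simp [I, mem_letterSlice]
  have neutral : ∀ j, ∀ z ∈ U F j, ∀ w ∈ U G (!j), (k : ℤ) ≤ |wordProd z w| := by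
    intro j z hz w hw
    obtain ⟨b, hb⟩ := (hU ..).1 hz
    obtain ⟨c, hc⟩ := (hU ..).1 hw
    simpa [wordProd_insertNth, letterProd] using h _ hb _ hc
  -- This needs `2 ≤ k`: otherwise `e = 0` escapes.
  have both : ∀ e : ℤ, (k : ℤ) ≤ |1 + e| → (k : ℤ) ≤ |-1 + e| → ((k + 1 : ℕ) : ℤ) ≤ |e| := by
    intro e h1 h2
    rcases le_abs.1 h1 with h1 | h1 <;> rcases le_abs.1 h2 with h2 | h2 <;>
      rw [le_abs] <;> push_cast <;> omega
  have widen : ∀ j, ∀ z ∈ U F j, ∀ w ∈ I G j, ((k + 1 : ℕ) : ℤ) ≤ |wordProd z w| := by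
    intro j z hz w hw
    obtain ⟨b, hb⟩ := (hU ..).1 hz
    have h1 := h _ hb _ ((hI ..).1 hw b)
    have h2 := h _ hb _ ((hI ..).1 hw (!b))
    simp [wordProd_insertNth, letterProd] at h1 h2
    exact both _ h1 h2
  have widen' : ∀ j, ∀ z ∈ I F j, ∀ w ∈ U G j, ((k + 1 : ℕ) : ℤ) ≤ |wordProd z w| := by
    intro j z hz w hw
    obtain ⟨b, hb⟩ := (hU ..).1 hw
    have h1 := h _ ((hI ..).1 hz b) _ hb
    have h2 := h _ ((hI ..).1 hz (!b)) _ hb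
    simp [wordProd_insertNth, letterProd] at h1 h2
    exact both _ h1 h2
  -- the sizes of unions and intersections in terms of the bias
  have sizes : ∀ H : Finset (Fin (M + 1) → Bool × Bool), H.Nonempty → bias H p ^ 2 ≤ 0.14 →
      ∃ a b : ℝ, 0 ≤ a ∧ a ≤ 1 ∧ 0 ≤ b ∧ b ≤ 1 ∧
        wordDens (U H false) = wordDens H * ((1 + bias H p) * (1 + a)) ∧
        wordDens (I H false) = wordDens H * ((1 + bias H p) * (1 - a)) ∧
        wordDens (U H true) = wordDens H * ((1 - bias H p) * (1 + b)) ∧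
        wordDens (I H true) = wordDens H * ((1 - bias H p) * (1 - b)) := by
    intro H hH hb
    have hs1 : 0 < 1 + bias H p := by nlinarith
    have hs2 : 0 < 1 - bias H p := by nlinarith
    have hd := wordDens_pos.2 hH
    have hc : (0 : ℝ) < H.card := by exact_mod_cast hH.card_pos
    have key : ∀ j, wordDens (U H j) + wordDens (I H j) =
        wordDens H * (2 * if j then 1 - bias H p else 1 + bias H p) := by
      intro j
      have e0 : wordDens (U H j) + wordDens (I H j) =
          ((letterSlice H p (j, false)).card + (letterSlice H p (j, true)).card : ℝ) / 4 ^ M := by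
        have := card_union_add_card_inter (letterSlice H p (j, false)) (letterSlice H p (j, true))
        simp only [wordDens, U, I, ← add_div]
        exact_mod_cast congrArg (fun n : ℕ => (n : ℝ) / 4 ^ M) this
      have e1 := sum_apply_eq_sum_card_letterSlice H p (fun _ => 1)
      have e2 := sum_apply_eq_sum_card_letterSlice H p classSign
      have e3 : ∑ x ∈ H, classSign (x p) = H.card * bias H p := by rw [bias]; field_simp
      simp [Fintype.sum_prod_type] at e1
      rw [e3] at e2
      simp [Fintype.sum_prod_type, classSign] at e2
      rw [e0, wordDens, pow_succ]
      field_simp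
      cases j <;> simp <;> linarith
    have le : ∀ j, wordDens (I H j) ≤ wordDens (U H j) := by
      intro j
      simp only [wordDens]
      gcongr
      exact inter_subset_union
    have ratio : ∀ j (q : ℝ), 0 < q → wordDens (U H j) + wordDens (I H j) = wordDens H * (2 * q) →
        ∃ a : ℝ, 0 ≤ a ∧ a ≤ 1 ∧ wordDens (U H j) = wordDens H * (q * (1 + a)) ∧
          wordDens (I H j) = wordDens H * (q * (1 - a)) := by
      intro j q hq hj
      have h0 : 0 < wordDens H * (2 * q) := by positivity
      refine ⟨(wordDens (U H j) - wordDens (I H j)) / (wordDens H * (2 * q)), ?_, ?_, ?_, ?_⟩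
      · exact div_nonneg (by linarith [le j]) h0.le
      · rw [div_le_one h0]; linarith [wordDens_nonneg (I H j)]
      · field_simp; linarith
      · field_simp; linarith
    obtain ⟨a, a0, a1, a2, a3⟩ := ratio false _ hs1 (by simpa using key false)
    obtain ⟨b, b0, b1, b2, b3⟩ := ratio true _ hs2 (by simpa using key true)
    exact ⟨a, b, a0, a1, b0, b1, a2, a3, b2, b3⟩
  obtain ⟨a, b, a0, a1, b0, b1, fa, fa', fb, fb'⟩ :=
    sizes F hF (by nlinarith [sq_nonneg (bias G p)])
  obtain ⟨c, d, c0, c1, d0, d1, gc, gc', gd, gd'⟩ :=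
    sizes G hG (by nlinarith [sq_nonneg (bias F p)])
  have hpos : 0 < wordDens F * wordDens G * (5 / 4) ^ k :=
    mul_pos (mul_pos (wordDens_pos.2 hF) (wordDens_pos.2 hG)) (by positivity)
  rcases gain_of_bias_small hp a0 a1 b0 b1 c0 c1 d0 d1 with g | g | g | g | g | g
  · refine ⟨U F false, U G true, k, hk, neutral false, ?_⟩
    rw [fa, gd]
    linarith [mul_le_mul_of_nonneg_right g hpos.le]
  · refine ⟨U F true, U G false, k, hk, neutral true, ?_⟩
    rw [fb, gc]
    linarith [mul_le_mul_of_nonneg_right g hpos.le]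
  · refine ⟨U F false, I G false, k + 1, by omega, widen false, ?_⟩
    rw [fa, gc', pow_succ]
    linarith [mul_le_mul_of_nonneg_right g hpos.le]
  · refine ⟨I F false, U G false, k + 1, by omega, widen' false, ?_⟩
    rw [fa', gc, pow_succ]
    linarith [mul_le_mul_of_nonneg_right g hpos.le]
  · refine ⟨U F true, I G true, k + 1, by omega, widen true, ?_⟩
    rw [fb, gd', pow_succ]
    linarith [mul_le_mul_of_nonneg_right g hpos.le]
  · refine ⟨I F true, U G true, k + 1, by omega, widen' true, ?_⟩
    rw [fb', gd, pow_succ]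
    linarith [mul_le_mul_of_nonneg_right g hpos.le]

/-- The Frankl–Rödl bound for a pair of sets: if no inner product lies strictly between `-k` and
`k`, where `k ≥ 2`, then the potential `log (wordDens F * wordDens G * (5 / 4) ^ k)` is smaller than
`log 2 - 0.0225 * M`. -/
theorem log_wordDens_lt_of_le_abs_wordProd {M : ℕ} {F G : Finset (Fin M → Bool × Bool)} {k : ℕ}
    (hF : F.Nonempty) (hG : G.Nonempty) (hk : 2 ≤ k)
    (h : ∀ x ∈ F, ∀ y ∈ G, (k : ℤ) ≤ |wordProd x y|) :
    Real.log (wordDens F) + Real.log (wordDens G) + k * Real.log (5 / 4) <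
      Real.log 2 - 0.0225 * M := by
  induction M generalizing k with
  | zero =>
    obtain ⟨x, hx⟩ := hF
    obtain ⟨y, hy⟩ := hG
    have := h x hx y hy
    simp [wordProd] at this
    omega
  | succ M ih =>
    by_contra! hcon
    have vol : ∀ {F G : Finset (Fin (M + 1) → Bool × Bool)}, F.Nonempty → G.Nonempty →
        (∀ x ∈ F, ∀ y ∈ G, (k : ℤ) ≤ |wordProd x y|) →
        Real.log (wordDens G) + k * Real.log (5 / 4) ≤ Real.log 2 + 0.0125 * (M + 1) := by
      intro F G ⟨x, hx⟩ hG h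
      have h1 := Real.log_le_log (mul_pos (wordDens_pos.2 hG) (by positivity))
        (wordDens_le_of_le_abs_wordProd (h x hx))
      rw [Real.log_mul (wordDens_pos.2 hG).ne' (by positivity), Real.log_pow,
        Real.log_mul (by norm_num) (by positivity), Real.log_pow] at h1
      have h2 := Real.log_le_sub_one_of_pos (by norm_num : (0 : ℝ) < 81 / 80)
      push_cast at h1
      nlinarith
    have v1 := vol hF hG h
    have v2 := vol hG hF fun x hx y hy => by rw [wordProd_comm]; exact h y hy x hx
    -- The deviation bounds `v1`, `v2` bound `(5 / 4) ^ k`, so a large potential forces the densities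
    -- to have `log (wordDens F * wordDens G) ≥ -0.07 * (M + 1)`; the level-one inequality then
    -- yields a position of small bias.
    obtain ⟨p, hp⟩ : ∃ p : Fin (M + 1), bias F p ^ 2 + bias G p ^ 2 ≤ 0.14 := by
      by_contra! hbig
      have h1 : ∑ p : Fin (M + 1), (0.14 : ℝ) <
          ∑ p : Fin (M + 1), (bias F p ^ 2 + bias G p ^ 2) :=
        sum_lt_sum_of_nonempty univ_nonempty fun p _ => hbig p
      rw [sum_add_distrib] at h1
      have h2 := sum_bias_sq_le hF
      have h3 := sum_bias_sq_le hG
      simp at h1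
      push_cast at hcon
      linarith
    obtain ⟨F', G', k', hk', h', hgain⟩ := exists_restriction hF hG hk h p hp
    have hpos : 0 < wordDens F * wordDens G * (5 / 4) ^ k :=
      mul_pos (mul_pos (wordDens_pos.2 hF) (wordDens_pos.2 hG)) (by positivity)
    have hpos' : 0 < wordDens F' * wordDens G' * (5 / 4) ^ k' := lt_of_lt_of_le (by positivity) hgain
    have hF' : 0 < wordDens F' := (wordDens_nonneg _).lt_of_ne fun h0 => by simp [← h0] at hpos'
    have hG' : 0 < wordDens G' := (wordDens_nonneg _).lt_of_ne fun h0 => by simp [← h0] at hpos'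
    -- The potential grows by `log 1.09 > 0.0225`, so the new sets violate the induction hypothesis.
    have hI := ih (wordDens_pos.1 hF') (wordDens_pos.1 hG') hk' h'
    have hl := Real.log_le_log (by positivity) hgain
    rw [Real.log_mul (by norm_num) hpos.ne',
      Real.log_mul (mul_pos (wordDens_pos.2 hF) (wordDens_pos.2 hG)).ne' (by positivity),
      Real.log_mul (wordDens_pos.2 hF).ne' (wordDens_pos.2 hG).ne', Real.log_pow,
      Real.log_mul (mul_pos hF' hG').ne' (by positivity),
      Real.log_mul hF'.ne' hG'.ne', Real.log_pow] at hl
    have h109 := Real.one_sub_inv_le_log_of_pos (by norm_num : (0 : ℝ) < 1.09)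
    norm_num at h109 hl hcon hI
    linarith

/-! ### Words as bit strings -/

/-- The two bits of a letter: its sign (`j = false`), and its sign plus its class (`j = true`), so
that the class is the parity of the two bits. -/
def letterBit (a : Bool × Bool) (j : Bool) : Bool := if j then xor a.1 a.2 else a.2

/-- The `n`-bit string made of the bits of the `M` letters of `x` and the `2 r` padding bits `w`,
placed according to `e`. -/
def encode {M r n : ℕ} (e : Fin n ≃ (Fin M × Bool) ⊕ (Fin r × Bool)) (w : Fin r × Bool → Bool)
    (x : Fin M → Bool × Bool) (i : Fin n) : Bool :=
  Sum.elim (fun q => letterBit (x q.1) q.2) w (e i)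

lemma hammingDist_encode {M r n : ℕ} (e : Fin n ≃ (Fin M × Bool) ⊕ (Fin r × Bool))
    (x y : Fin M → Bool × Bool) :
    (hammingDist (encode e (fun _ => false) x) (encode e Prod.snd y) : ℤ) =
      M + r - wordProd x y := by
  have h1 : (hammingDist (encode e (fun _ => false) x) (encode e Prod.snd y) : ℤ) =
      ∑ i, ((xor (Sum.elim (fun q => letterBit (x q.1) q.2) (fun _ => false) (e i))
        (Sum.elim (fun q => letterBit (y q.1) q.2) Prod.snd (e i))).toNat : ℤ) := by
    rw [hammingDist, card_filter]
    push_cast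
    refine sum_congr rfl fun i _ => ?_
    rw [← encode, ← encode]
    cases encode e (fun _ => false) x i <;> cases encode e Prod.snd y i <;> rfl
  have h2 : ∀ a b : Bool × Bool,
      (∑ j, ((xor (letterBit a j) (letterBit b j)).toNat : ℤ)) = 1 - letterProd a b := by
    decide
  rw [h1, e.sum_comp (fun q => ((xor (Sum.elim (fun q => letterBit (x q.1) q.2)
    (fun _ => false) q) (Sum.elim (fun q => letterBit (y q.1) q.2) Prod.snd q)).toNat : ℤ)),
    Fintype.sum_sum_type, Fintype.sum_prod_type, Fintype.sum_prod_type]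
  simp only [Sum.elim_inl, Sum.elim_inr, h2, wordProd]
  simp
  ring

lemma wordProd_self {M : ℕ} (x : Fin M → Bool × Bool) : wordProd x x = M := by
  simp [wordProd, letterProd]

/-- The parity of the number of letters of class `true`. -/
def classParity {M : ℕ} (x : Fin M → Bool × Bool) : ZMod 2 :=
  ∑ p, if (x p).1 then 1 else 0

lemma even_wordProd {M : ℕ} (hM : Even M) {x y : Fin M → Bool × Bool}
    (h : classParity x = classParity y) : Even (wordProd x y) := by
  rw [← ZMod.intCast_eq_zero_iff_even]
  have h2 : ∀ a b : Bool × Bool, ((letterProd a b : ℤ) : ZMod 2) =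
      1 + (if a.1 then 1 else 0) + (if b.1 then 1 else 0) := by decide
  simp only [wordProd, Int.cast_sum, h2, sum_add_distrib]
  change _ + classParity x + classParity y = 0
  rw [h, add_assoc, CharTwo.add_self_eq_zero, add_zero]
  simpa using (ZMod.natCast_eq_zero_iff_even).2 hM

/-! ### Protocols -/

namespace CommProtocol

/-- Among the diagonal pairs `(a z, b z)`, a `2⁻ᶜ` fraction ends in one leaf of a protocol that
exchanges at most `c` bits on them. As a leaf is a rectangle, the output on `(a z, b w)` is then the
same for all such `z` and `w`. -/
lemma exists_card_le_of_bits_le {X Y Z : Type} (a : Z → X) (b : Z → Y) (P : CommProtocol X Y)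
    (c : ℕ) (Ω : Finset Z) (h : ∀ z ∈ Ω, P.bits (a z) (b z) ≤ c) :
    ∃ Ω' ⊆ Ω, Ω.card ≤ 2 ^ c * Ω'.card ∧
      ∃ v, ∀ z ∈ Ω', ∀ w ∈ Ω', P.eval (a z) (b w) = v := by
  classical
  have half : ∀ (Ω : Finset Z) (p : Z → Bool), ∃ t, Ω.card ≤ 2 * (Ω.filter (p · = t)).card := by
    intro Ω p
    have := card_filter_add_card_filter_not (s := Ω) (p · = true)
    simp only [Bool.not_eq_true] at this
    by_cases h : Ω.card ≤ 2 * (Ω.filter (p · = true)).card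
    · exact ⟨true, h⟩
    · exact ⟨false, by omega⟩
  induction P generalizing c Ω with
  | output v =>
    exact ⟨Ω, Subset.rfl, Nat.le_mul_of_pos_left _ (by positivity), v, fun _ _ _ _ => rfl⟩
  | alice m P₀ P₁ h₀ h₁ =>
    rcases Ω.eq_empty_or_nonempty with rfl | ⟨z₀, hz₀⟩
    · exact ⟨∅, Subset.rfl, by simp, true, by simp⟩
    obtain ⟨c, rfl⟩ : ∃ c', c = c' + 1 :=
      Nat.exists_eq_add_one.2 (by have := h z₀ hz₀; simp only [bits] at this; omega)
    obtain ⟨t, ht⟩ := half Ω fun z => m (a z)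
    have hrec : ∃ Ω' ⊆ Ω.filter fun z => m (a z) = t,
        (Ω.filter fun z => m (a z) = t).card ≤ 2 ^ c * Ω'.card ∧
        ∃ v, ∀ z ∈ Ω', ∀ w ∈ Ω', (if t then P₁ else P₀).eval (a z) (b w) = v := by
      cases t
      · refine h₀ c _ fun z hz => ?_
        have hz := mem_filter.1 hz
        simpa [bits, hz.2] using h z hz.1
      · refine h₁ c _ fun z hz => ?_
        have hz := mem_filter.1 hz
        simpa [bits, hz.2] using h z hz.1
    obtain ⟨Ω', hsub, hcard, v, hv⟩ := hrec
    refine ⟨Ω', hsub.trans (filter_subset _ _), ?_, v, fun z hz w hw => ?_⟩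
    · rw [pow_succ]; linarith
    · rw [← hv z hz w hw, eval, (mem_filter.1 (hsub hz)).2]
      cases t <;> rfl
  | bob m P₀ P₁ h₀ h₁ =>
    rcases Ω.eq_empty_or_nonempty with rfl | ⟨z₀, hz₀⟩
    · exact ⟨∅, Subset.rfl, by simp, true, by simp⟩
    obtain ⟨c, rfl⟩ : ∃ c', c = c' + 1 :=
      Nat.exists_eq_add_one.2 (by have := h z₀ hz₀; simp only [bits] at this; omega)
    obtain ⟨t, ht⟩ := half Ω fun z => m (b z)
    have hrec : ∃ Ω' ⊆ Ω.filter fun z => m (b z) = t,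
        (Ω.filter fun z => m (b z) = t).card ≤ 2 ^ c * Ω'.card ∧
        ∃ v, ∀ z ∈ Ω', ∀ w ∈ Ω', (if t then P₁ else P₀).eval (a z) (b w) = v := by
      cases t
      · refine h₀ c _ fun z hz => ?_
        have hz := mem_filter.1 hz
        simpa [bits, hz.2] using h z hz.1
      · refine h₁ c _ fun z hz => ?_
        have hz := mem_filter.1 hz
        simpa [bits, hz.2] using h z hz.1
    obtain ⟨Ω', hsub, hcard, v, hv⟩ := hrec
    refine ⟨Ω', hsub.trans (filter_subset _ _), ?_, v, fun z hz w hw => ?_⟩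
    · rw [pow_succ]; linarith
    · rw [← hv z hz w hw, eval, (mem_filter.1 (hsub hw)).2]
      cases t <;> rfl

/-- Alice can announce her input, whereupon Bob sends the value of `g`. -/
lemma exists_eval_eq {X Y : Type} [Fintype X] (g : X → Y → Bool) :
    ∃ P : CommProtocol X Y, ∀ x y, P.eval x y = g x y := by
  classical
  suffices h : ∀ S : Finset X, ∃ P : CommProtocol X Y, ∀ x ∈ S, ∀ y, P.eval x y = g x y by
    simpa using h univ
  intro S
  induction S using Finset.induction_on with
  | empty => exact ⟨output true, by simp⟩
  | insert x₀ S _ ih =>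
    obtain ⟨P, hP⟩ := ih
    refine ⟨alice (fun x => decide (x = x₀)) P
      (bob (fun y => g x₀ y) (output false) (output true)), fun x hx y => ?_⟩
    by_cases hxx : x = x₀
    · subst hxx; simp [eval]
    · simpa [eval, hxx] using hP x (mem_of_mem_insert_of_ne hx hxx) y

/-- The infimum in the definition of `detCommComplexity` is attained on finite input sets. -/
lemma exists_computes_bits_le {X Y : Type} [Fintype X] [Fintype Y] (f : X → Y → Option Bool) :
    ∃ P : CommProtocol X Y, P.Computes f ∧
      ∀ x y, f x y ≠ none → P.bits x y ≤ detCommComplexity f := by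
  refine Nat.sInf_mem (s := {c | ∃ P : CommProtocol X Y, P.Computes f ∧
    ∀ x y, f x y ≠ none → P.bits x y ≤ c}) ?_
  obtain ⟨P, hP⟩ := exists_eval_eq fun x y => (f x y).getD true
  refine ⟨univ.sup fun q : X × Y => P.bits q.1 q.2, P, fun x y v h => by simp [hP, h],
    fun x y _ => ?_⟩
  exact le_sup (f := fun q : X × Y => P.bits q.1 q.2) (mem_univ (x, y))

end CommProtocol

/-! ### The lower bound -/

lemma EQPrime_eq_some_true {n : ℕ} {x y : Fin n → Bool} (h : hammingDist x y ≤ 1) :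
    EQPrime n x y = some true := by
  rw [EQPrime, if_pos (by omega)]

lemma EQPrime_eq_some_false {n : ℕ} (hn : 4 ≤ n) {x y : Fin n → Bool}
    (h : 2 * hammingDist x y = n) : EQPrime n x y = some false := by
  rw [EQPrime, if_neg (by omega), if_pos h]

lemma one_le_detCommComplexity_EQPrime {n : ℕ} (hn : 4 ≤ n) (he : Even n) :
    1 ≤ detCommComplexity (EQPrime n) := by
  obtain ⟨P, hP, hb⟩ := CommProtocol.exists_computes_bits_le (EQPrime n)
  by_contra! h
  have h1 : EQPrime n (fun _ => false) (fun _ => false) = some true :=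
    EQPrime_eq_some_true (by simp)
  have h2 : EQPrime n (fun _ => false) (fun i => decide ((i : ℕ) < n / 2)) = some false := by
    refine EQPrime_eq_some_false hn ?_
    have : hammingDist (fun _ : Fin n => false) (fun i => decide ((i : ℕ) < n / 2)) = n / 2 := by
      have : (univ.filter fun i : Fin n => (i : ℕ) < n / 2).card = min n (n / 2) :=
        Fin.card_filter_val_lt ..
      simp [hammingDist, this]
      omega
    rw [this]
    have := Nat.div_mul_cancel he.two_dvd
    omega
  have hb1 := hb _ _ (by rw [h1]; simp)
  have e1 := hP _ _ _ h1
  have e2 := hP _ _ _ h2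
  cases P with
  | output v => simp [CommProtocol.eval] at e1 e2; simp [e1] at e2
  | alice => simp [CommProtocol.bits] at hb1; omega
  | bob => simp [CommProtocol.bits] at hb1; omega

/-- The lower bound at `n = 2 M + 2 r`. Alice's padding is constant and Bob's has `r` ones, so all
diagonal pairs have distance `r`, which is promised to have the value `1` for `r ≤ 1`. -/
lemma lt_detCommComplexity_EQPrime {M r n : ℕ} (hM : Even M) (hM2 : 2 ≤ M) (hr : r ≤ 1)
    (hn : n = 2 * M + 2 * r) :
    0.0225 * (M : ℝ) < (2 * detCommComplexity (EQPrime n) + 3) * Real.log 2 := by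
  classical
  set D := detCommComplexity (EQPrime n) with hD
  obtain ⟨P, hP, hb⟩ := CommProtocol.exists_computes_bits_le (EQPrime n)
  obtain ⟨e⟩ : Nonempty (Fin n ≃ (Fin M × Bool) ⊕ (Fin r × Bool)) :=
    Fintype.card_eq.1 (by simp; omega)
  have hdiag : ∀ x : Fin M → Bool × Bool,
      EQPrime n (encode e (fun _ => false) x) (encode e Prod.snd x) = some true := by
    intro x
    have := hammingDist_encode e x x
    rw [wordProd_self] at this
    exact EQPrime_eq_some_true (by omega)
  obtain ⟨S, -, hS, v, hv⟩ := CommProtocol.exists_card_le_of_bits_le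
    (encode e fun _ => false) (encode e Prod.snd) P D univ
    fun x _ => hb _ _ (by rw [hdiag]; simp)
  obtain ⟨t, ht⟩ : ∃ t, S.card ≤ 2 * (S.filter (classParity · = t)).card := by
    have := card_eq_sum_card_fiberwise (s := S) (t := univ) (f := classParity)
      (fun _ _ => mem_coe.2 (mem_univ _))
    have h2 : ∑ t : ZMod 2, (S.filter (classParity · = t)).card =
      (S.filter (classParity · = 0)).card + (S.filter (classParity · = 1)).card :=
      Fin.sum_univ_two _
    rw [h2] at this
    by_contra! hcon
    have h0 := hcon 0
    have h1 := hcon 1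
    omega
  -- On a set of constant class parity the inner products are even and nonzero.
  set F := S.filter (classParity · = t) with hF
  have hcard : 4 ^ M ≤ 2 ^ (D + 1) * F.card := by
    have : (univ : Finset (Fin M → Bool × Bool)).card = 4 ^ M := by simp
    rw [this] at hS
    calc 4 ^ M ≤ 2 ^ D * S.card := hS
      _ ≤ 2 ^ D * (2 * F.card) := by gcongr
      _ = _ := by ring
  have hne : F.Nonempty := by
    rw [nonempty_iff_ne_empty]
    intro h0
    simp [h0] at hcard
  have hprod : ∀ x ∈ F, ∀ y ∈ F, ((2 : ℕ) : ℤ) ≤ |wordProd x y| := by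
    intro x hx y hy
    obtain ⟨hxS, hxt⟩ := mem_filter.1 hx
    obtain ⟨hyS, hyt⟩ := mem_filter.1 hy
    have hev := even_wordProd hM (hxt.trans hyt.symm)
    have h0 : wordProd x y ≠ 0 := by
      intro h0
      have hd := hammingDist_encode e x y
      have hfalse := hP _ _ _ (EQPrime_eq_some_false (by omega)
        (x := encode e (fun _ => false) x) (y := encode e Prod.snd y) (by omega))
      rw [hv x hxS y hyS, ← hv x hxS x hxS, hP _ _ _ (hdiag x)] at hfalse
      cases hfalse
    obtain ⟨q, hq⟩ := hev
    rcases lt_or_gt_of_ne h0 with h | h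
    · rw [abs_of_neg h]; push_cast; omega
    · rw [abs_of_pos h]; push_cast; omega
  have hlog := log_wordDens_lt_of_le_abs_wordProd hne hne le_rfl hprod
  have hdens : ((2 : ℝ) ^ (D + 1))⁻¹ ≤ wordDens F := by
    rw [wordDens, le_div_iff₀ (by positivity), inv_mul_le_iff₀ (by positivity)]
    exact_mod_cast hcard
  have hl := Real.log_le_log (by positivity) hdens
  rw [Real.log_inv, Real.log_pow] at hl
  have h54 := Real.log_nonneg (by norm_num : (1 : ℝ) ≤ 5 / 4)
  push_cast at hl hlog
  linarith

theorem mainTheorem2 :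
    (∃ c : ℝ, 0 < c ∧ ∀ n : ℕ, 4 ≤ n → Even n →
      c * (n : ℝ) ≤ (detCommComplexity (EQPrime n) : ℝ)) ∧
    (∃ N : ℕ, ∀ n : ℕ, N ≤ n → Even n →
      (0.0072 : ℝ) * (n : ℝ) < (detCommComplexity (EQPrime n) : ℝ)) := by
  have large : ∀ n : ℕ, 2000 ≤ n → Even n →
      (0.0072 : ℝ) * (n : ℝ) < (detCommComplexity (EQPrime n) : ℝ) := by
    rintro n hn ⟨m, hm⟩
    obtain ⟨M, r, hM, hr, hMr⟩ : ∃ M r, Even M ∧ r ≤ 1 ∧ m = M + r :=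
      ⟨2 * (m / 2), m % 2, even_two_mul _, by omega, by omega⟩
    have h := lt_detCommComplexity_EQPrime (n := n) hM (by omega) hr (by omega)
    have h2 := Real.log_two_lt_d9
    have hnM : (n : ℝ) ≤ 2 * M + 2 := by exact_mod_cast (by omega : n ≤ 2 * M + 2)
    have hn' : (2000 : ℝ) ≤ n := by exact_mod_cast hn
    -- The rates compare as `4 * 0.0072 * log 2 < 0.01997 < 0.0225`.
    by_contra! hcon
    have h3 : (2 * (detCommComplexity (EQPrime n) : ℝ) + 3) * Real.log 2 ≤
        (2 * (0.0072 * (2 * M + 2)) + 3) * 0.69315 := by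
      gcongr <;> linarith
    linarith
  refine ⟨⟨1 / 2000, by norm_num, fun n hn he => ?_⟩, 2000, large⟩
  rcases le_or_gt 2000 n with h | h
  · have := large n h he
    have : (0 : ℝ) ≤ n := by positivity
    linarith
  · have h1 : (1 : ℝ) ≤ detCommComplexity (EQPrime n) := by
      exact_mod_cast one_le_detCommComplexity_EQPrime hn he
    have : (n : ℝ) ≤ 2000 := by exact_mod_cast h.le
    linarith
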